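/- A locally $C^*$-algebra $A$ is a complete Hausdorff topological $*$-algebra over $\mathbb{C}$ (not necessarily unital) whose topology is defined by an upward directed family $\{p_\lambda\}_{\lambda\in\Lambda}$, $\Lambda\neq\emptyset$, of $C^*$-seminorms (that is, submultiplicative seminorms with $p_\lambda(a^*a)=p_\lambda(a)^2$). A continuous linear functional $f$ on a topological $*$-algebra is positive if $f(a^*a)\ge 0$ for all $a$; a continuous positive functional $f$ is pure if $f\neq 0$ and every continuous positive functional $g\le f$ (i.e. with $f-g$ positive) is of the form $g=\alpha f$ with $\alpha\in[0,1]$. A locally $C^*$-algebra (in particular, a $C^*$-algebra) is scattered if every continuous positive functional $f$ on it is a countable (finite, possibly empty, or infinite) sum $f=\sum_n f_n$, converging pointwise, of pure functionals $f_n$. Let $A$ be a locally $C^*$-algebra with defining family of $C^*$-seminorms $\{p_\lambda\}_{\lambda\in\Lambda}$ as above, and let $b(A)=\{a\in A:\ \sup_{\lambda}p_\lambda(a)<\infty\}$ be the $*$-algebra of bounded elements, which is a $C^*$-algebra in the norm $\|a\|_\infty=\sup_{\lambda}p_\lambda(a)$. For each $\lambda\in\Lambda$, the set $\ker p_\lambda\cap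 b(A)=\{a\in b(A): p_\lambda(a)=0\}$ is a closed two-sided $*$-ideal of $b(A)$, hence a $C^*$-algebra in the norm $\|\cdot\|_\infty$. 1. If the $C^*$-algebra $b(A)$ is scattered, then $A$ is scattered. 2. If $A$ is scattered and, for some $\lambda\in\Lambda$, the $C^*$-algebra $\ker p_\lambda\cap b(A)$ is scattered, then $b(A)$ is scattered. -/

import Mathlib

noncomputable section

namespace LocallyCStar

section Scattered

variable {A : Type*} [NonUnitalRing A] [StarRing A] [Module ℂ A] [TopologicalSpace A]

open scoped ComplexOrder in
/-- A continuous linear functional `f` is positive if `f (a⋆ a) ≥ 0` (real and nonnegative)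
for all `a`. -/
def IsPositive (f : A →L[ℂ] ℂ) : Prop :=
  ∀ a : A, 0 ≤ f (star a * a)

/-- A continuous positive functional `f` is pure if `f ≠ 0` and the only positive functionals
`g ≤ f` (i.e. with `f - g` positive) are the multiples `α f` with `α ∈ [0, 1]`. -/
def IsPure (f : A →L[ℂ] ℂ) : Prop :=
  IsPositive f ∧ f ≠ 0 ∧
    ∀ g : A →L[ℂ] ℂ, IsPositive g → IsPositive (f - g) →
      ∃ α : ℝ, α ∈ Set.Icc (0 : ℝ) 1 ∧ g = (α : ℂ) • f

variable (A) in
/-- A topological `*`-algebra is scattered if every continuous positive functional on it is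
a countable (finite, possibly empty, or infinite) pointwise convergent sum of pure functionals. -/
def IsScattered : Prop :=
  ∀ f : A →L[ℂ] ℂ, IsPositive f →
    ∃ (ι : Type) (_ : Countable ι) (F : ι → A →L[ℂ] ℂ),
      (∀ i, IsPure (F i)) ∧ ∀ a : A, HasSum (fun i => F i a) (f a)

end Scattered

variable {A : Type*} [NonUnitalRing A] [StarRing A] [Module ℂ A] [IsScalarTower ℂ A A]
  [SMulCommClass ℂ A A] [StarModule ℂ A] [UniformSpace A] [IsUniformAddGroup A]
  {Λ : Type*} [Nonempty Λ]

/-- The complex `*`-algebra `A` is a locally C⋆-algebra with defining family `p` of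
C⋆-seminorms: `A` is complete and Hausdorff, and its topology is the one given by
the upward directed family `p`. -/
structure IsLocallyCStarAlgebra (p : Λ → Seminorm ℂ A) : Prop where
  t2Space : T2Space A
  completeSpace : CompleteSpace A
  withSeminorms : WithSeminorms p
  directed : Directed (· ≤ ·) p
  map_mul_le : ∀ (l : Λ) (a b : A), p l (a * b) ≤ p l a * p l b
  map_star_mul_self : ∀ (l : Λ) (a : A), p l (star a * a) = p l a ^ 2

set_option linter.unusedSectionVars false

variable {p : Λ → Seminorm ℂ A}

theorem IsLocallyCStarAlgebra.map_star (hp : IsLocallyCStarAlgebra p) (l : Λ) (a : A) :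
    p l (star a) = p l a := by
  have key : ∀ b : A, p l b ≤ p l (star b) := by
    intro b
    have h1 := hp.map_star_mul_self l b
    have h2 := hp.map_mul_le l (star b) b
    rcases (apply_nonneg (p l) b).eq_or_lt with h | h
    · rw [← h]; exact apply_nonneg _ _
    · nlinarith
  refine le_antisymm ?_ (key a)
  simpa using key (star a)

theorem IsLocallyCStarAlgebra.eq_zero (hp : IsLocallyCStarAlgebra p) {a : A}
    (h : ∀ l, p l a = 0) : a = 0 := by
  have := hp.t2Space
  by_contra hne
  obtain ⟨l, hl⟩ := hp.withSeminorms.separating_of_T1 a hne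
  exact hl (h l)

/-- The `*`-subalgebra of the elements `a` with `sup_λ p_λ(a) < ∞`. -/
def boundedSubalgebra (hp : IsLocallyCStarAlgebra p) : NonUnitalStarSubalgebra ℂ A where
  carrier := {a | BddAbove (Set.range fun l => p l a)}
  add_mem' := by
    rintro a b ⟨C, hC⟩ ⟨D, hD⟩
    refine ⟨C + D, ?_⟩
    rintro _ ⟨l, rfl⟩
    exact (map_add_le_add (p l) a b).trans (add_le_add (hC ⟨l, rfl⟩) (hD ⟨l, rfl⟩))
  zero_mem' := ⟨0, by rintro _ ⟨l, rfl⟩; simp⟩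
  mul_mem' := by
    rintro a b ⟨C, hC⟩ ⟨D, hD⟩
    refine ⟨C * D, ?_⟩
    rintro _ ⟨l, rfl⟩
    exact (hp.map_mul_le l a b).trans (mul_le_mul (hC ⟨l, rfl⟩) (hD ⟨l, rfl⟩)
      (apply_nonneg _ _) ((apply_nonneg (p l) a).trans (hC ⟨l, rfl⟩)))
  smul_mem' := by
    rintro c a ⟨C, hC⟩
    refine ⟨‖c‖ * C, ?_⟩
    rintro _ ⟨l, rfl⟩
    simp only [map_smul_eq_mul]
    exact mul_le_mul_of_nonneg_left (hC ⟨l, rfl⟩) (norm_nonneg c)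
  star_mem' := by
    rintro a ⟨C, hC⟩
    refine ⟨C, ?_⟩
    rintro _ ⟨l, rfl⟩
    simp only [hp.map_star]
    exact hC ⟨l, rfl⟩

/-- The algebra `b(A)` of bounded elements. This is a type of its own, because it carries
the topology of the norm `‖a‖_∞ = sup_λ p_λ(a)` and not the one induced from `A`. -/
def BoundedElements (hp : IsLocallyCStarAlgebra p) : Type _ := boundedSubalgebra hp

namespace BoundedElements

variable {hp : IsLocallyCStarAlgebra p}

instance : NonUnitalRing (BoundedElements hp) :=
  inferInstanceAs (NonUnitalRing (boundedSubalgebra hp))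
instance : StarRing (BoundedElements hp) :=
  inferInstanceAs (StarRing (boundedSubalgebra hp))
instance : Module ℂ (BoundedElements hp) :=
  inferInstanceAs (Module ℂ (boundedSubalgebra hp))
instance : IsScalarTower ℂ (BoundedElements hp) (BoundedElements hp) :=
  inferInstanceAs (IsScalarTower ℂ (boundedSubalgebra hp) (boundedSubalgebra hp))
instance : SMulCommClass ℂ (BoundedElements hp) (BoundedElements hp) :=
  inferInstanceAs (SMulCommClass ℂ (boundedSubalgebra hp) (boundedSubalgebra hp))
instance : StarModule ℂ (BoundedElements hp) :=
  inferInstanceAs (StarModule ℂ (boundedSubalgebra hp))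

variable (hp) in
/-- The inclusion `b(A) → A`. -/
def incl : BoundedElements hp →⋆ₙₐ[ℂ] A :=
  NonUnitalStarSubalgebraClass.subtype (boundedSubalgebra hp)

theorem incl_injective : Function.Injective (incl hp) := Subtype.val_injective

theorem bddAbove (a : BoundedElements hp) : BddAbove (Set.range fun l => p l (incl hp a)) :=
  a.2

/-- The norm `‖a‖_∞ = sup_λ p_λ(a)`. -/
instance : Norm (BoundedElements hp) := ⟨fun a => ⨆ l, p l (incl hp a)⟩

theorem norm_def (a : BoundedElements hp) : ‖a‖ = ⨆ l, p l (incl hp a) := rfl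

theorem le_norm (l : Λ) (a : BoundedElements hp) : p l (incl hp a) ≤ ‖a‖ :=
  le_ciSup a.bddAbove l

theorem norm_le {a : BoundedElements hp} {C : ℝ} (h : ∀ l, p l (incl hp a) ≤ C) : ‖a‖ ≤ C :=
  ciSup_le h

instance : NormedAddCommGroup (BoundedElements hp) :=
  AddGroupNorm.toNormedAddCommGroup
    { toFun := fun a => ‖a‖
      map_zero' := by simp [norm_def]
      add_le' := fun a b => norm_le fun l => by
        rw [map_add]
        exact (map_add_le_add (p l) _ _).trans (add_le_add (le_norm l a) (le_norm l b))
      neg' := fun a => by simp [norm_def, map_neg_eq_map]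
      eq_zero_of_map_eq_zero' := fun a ha => by
        apply incl_injective (hp := hp)
        rw [map_zero]
        exact hp.eq_zero fun l => le_antisymm ((le_norm l a).trans ha.le) (apply_nonneg _ _) }

instance : NonUnitalNormedRing (BoundedElements hp) :=
  { (inferInstance : NormedAddCommGroup (BoundedElements hp)),
    (inferInstance : NonUnitalRing (BoundedElements hp)) with
    norm_mul_le := fun a b => norm_le fun l => by
      rw [map_mul]
      exact (hp.map_mul_le l _ _).trans (mul_le_mul (le_norm l a) (le_norm l b)
        (apply_nonneg _ _) ((apply_nonneg (p l) _).trans (le_norm l a))) }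

instance : NormedSpace ℂ (BoundedElements hp) where
  norm_smul_le c a := norm_le fun l => by
    rw [map_smul, map_smul_eq_mul]
    exact mul_le_mul_of_nonneg_left (le_norm l a) (norm_nonneg c)

instance : CStarRing (BoundedElements hp) where
  norm_mul_self_le a := by
    have h : ‖a‖ ≤ √‖star a * a‖ := norm_le fun l => Real.le_sqrt_of_sq_le (by
      rw [← hp.map_star_mul_self, ← StarHomClass.map_star, ← map_mul]
      exact le_norm l _)
    calc ‖a‖ * ‖a‖ ≤ √‖star a * a‖ * √‖star a * a‖ :=
          mul_le_mul h h (norm_nonneg _) (Real.sqrt_nonneg _)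
      _ = ‖star a * a‖ := Real.mul_self_sqrt (norm_nonneg _)

theorem continuous_incl : Continuous (incl hp) := by
  refine continuous_of_continuousAt_zero (incl hp) ?_
  rw [ContinuousAt, hp.withSeminorms.tendsto_nhds]
  intro l ε hε
  filter_upwards [Metric.ball_mem_nhds (0 : BoundedElements hp) hε] with a ha
  rw [mem_ball_zero_iff] at ha
  simpa using (le_norm l a).trans_lt ha

instance : CompleteSpace (BoundedElements hp) := by
  have := hp.completeSpace
  refine Metric.complete_of_cauchySeq_tendsto fun u hu => ?_
  have hv : CauchySeq fun n => incl hp (u n) :=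
    hu.map (uniformContinuous_addMonoidHom_of_continuous (f := incl hp) continuous_incl)
  obtain ⟨a, ha⟩ := cauchySeq_tendsto_of_complete hv
  have key : ∀ ε > 0, ∃ N, ∀ n ≥ N, ∀ l, p l (incl hp (u n) - a) ≤ ε := by
    intro ε hε
    obtain ⟨N, hN⟩ := Metric.cauchySeq_iff.1 hu ε hε
    refine ⟨N, fun n hn l => ?_⟩
    have hc : Filter.Tendsto (fun m => p l (incl hp (u n) - incl hp (u m))) Filter.atTop
        (nhds (p l (incl hp (u n) - a))) :=
      ((hp.withSeminorms.continuous_seminorm l).tendsto _).comp (tendsto_const_nhds.sub ha)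
    refine le_of_tendsto hc ?_
    filter_upwards [Filter.eventually_ge_atTop N] with m hm
    rw [← map_sub]
    refine (le_norm l _).trans ?_
    rw [← dist_eq_norm]
    exact (hN n hn m hm).le
  have hb : a ∈ boundedSubalgebra hp := by
    obtain ⟨N, hN⟩ := key 1 one_pos
    refine ⟨‖u N‖ + 1, ?_⟩
    rintro _ ⟨l, rfl⟩
    calc p l a = p l (incl hp (u N) - (incl hp (u N) - a)) := by simp
      _ ≤ p l (incl hp (u N)) + p l (incl hp (u N) - a) := map_sub_le_add _ _ _
      _ ≤ ‖u N‖ + 1 := add_le_add (le_norm l _) (hN N le_rfl l)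
  obtain ⟨b, rfl⟩ : ∃ b : BoundedElements hp, incl hp b = a := ⟨⟨a, hb⟩, rfl⟩
  refine ⟨b, Metric.tendsto_atTop.2 fun ε hε => ?_⟩
  obtain ⟨N, hN⟩ := key (ε / 2) (half_pos hε)
  refine ⟨N, fun n hn => ?_⟩
  rw [dist_eq_norm]
  refine (norm_le fun l => ?_).trans_lt (half_lt_self hε)
  rw [map_sub]
  exact hN n hn l

/-- `b(A)` with the norm `‖·‖_∞` is a C⋆-algebra. -/
instance : NonUnitalCStarAlgebra (BoundedElements hp) where

variable (hp) in
/-- The ideal `ker p_λ ∩ b(A)` of `b(A)`, with the topology of the norm `‖·‖_∞`. -/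
def kerIdeal (l : Λ) : NonUnitalStarSubalgebra ℂ (BoundedElements hp) where
  carrier := {a | p l (incl hp a) = 0}
  add_mem' {a b} ha hb := by
    refine le_antisymm ?_ (apply_nonneg _ _)
    rw [map_add]
    exact (map_add_le_add (p l) _ _).trans (add_le_add ha.le hb.le |>.trans (by simp))
  zero_mem' := by simp
  mul_mem' {a b} ha hb := by
    refine le_antisymm ?_ (apply_nonneg _ _)
    rw [map_mul]
    refine (hp.map_mul_le l _ _).trans ?_
    rw [show p l (incl hp a) = 0 from ha, zero_mul]
  smul_mem' c a ha := by
    show p l (incl hp (c • a)) = 0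
    rw [map_smul, map_smul_eq_mul, show p l (incl hp a) = 0 from ha, mul_zero]
  star_mem' {a} ha := by
    show p l (incl hp (star a)) = 0
    rw [StarHomClass.map_star, hp.map_star]
    exact ha

end BoundedElements

end LocallyCStar

end

noncomputable section

open Filter Topology
open scoped ComplexOrder

namespace LocallyCStar

set_option linter.unusedSectionVars false

/-! ### Positive functionals. -/

section StarAlgebra

variable {A : Type*} [NonUnitalRing A] [StarRing A] [Module ℂ A] [TopologicalSpace A]

/-! A continuous functional on `A` is bounded by a single `p l`, hence kills `ker p l`. Modulo `ker
p l`, every `a` agrees with a bounded element of norm at most `2 * p l a`, obtained by truncating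
the real and imaginary parts of `a` with functional calculus. So restriction to `b(A)` is injective
on functionals, preserves and reflects positivity, and its image consists of the functionals that
kill some `ker p l ∩ b(A)`. By Cauchy–Schwarz a positive functional dominated by one of these kills
the same ideal, so purity is also preserved and reflected (`isPure_pullback_iff`).

For part 1, the pure summands of the restriction of `f` are dominated by it, so they descend to `A`.

For part 2, let `f` be positive on `b(A)` and `I = ker p l ∩ b(A)`. Each pure summand of `f` on `I`
has a least positive extension to `b(A)`; it has the same norm and is again pure. Norms of positive
functionals add, so these extensions sum in norm to a functional below `f`. The remainder is
positive and kills `I`, so it comes from `A`, where it is a sum of pure functionals. -/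

theorem IsPositive.add {f g : A →L[ℂ] ℂ} (hf : IsPositive f) (hg : IsPositive g) :
    IsPositive (f + g) := fun a => add_nonneg (hf a) (hg a)

theorem IsPositive.sum {ι : Type*} {F : ι → A →L[ℂ] ℂ} (s : Finset ι)
    (hF : ∀ i ∈ s, IsPositive (F i)) : IsPositive (∑ i ∈ s, F i) := fun a => by
  rw [sum_apply]
  exact Finset.sum_nonneg fun i hi => hF i hi a

theorem IsPositive.smul {f : A →L[ℂ] ℂ} (hf : IsPositive f) {r : ℝ} (hr : 0 ≤ r) :
    IsPositive ((r : ℂ) • f) := fun a => by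
  simpa using mul_nonneg (by exact_mod_cast hr) (hf a)

/-- Each term of a pointwise convergent sum of positive functionals is dominated by the sum. -/
theorem IsPositive.apply_le_of_hasSum {ι : Type*} {F : ι → A →L[ℂ] ℂ} {f : A →L[ℂ] ℂ}
    (hF : ∀ i, IsPositive (F i)) (hsum : ∀ a, HasSum (fun i => F i a) (f a)) (i : ι) (a : A) :
    F i (star a * a) ≤ f (star a * a) :=
  le_hasSum (hsum _) i fun j _ => hF j a

end StarAlgebra

/-! ### Cauchy–Schwarz and norms of positive functionals on C⋆-algebras. -/

section CStar

variable {C : Type*} [NonUnitalCStarAlgebra C]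

theorem IsPositive.apply_nonneg [PartialOrder C] [StarOrderedRing C] {f : C →L[ℂ] ℂ}
    (hf : IsPositive f) {x : C} (hx : 0 ≤ x) : 0 ≤ f x := by
  obtain ⟨y, rfl⟩ := CStarAlgebra.nonneg_iff_eq_star_mul_self.1 hx
  exact hf y

/-- The Cauchy–Schwarz inequality for positive functionals. -/
theorem IsPositive.norm_apply_star_mul_sq_le {f : C →L[ℂ] ℂ} (hf : IsPositive f) (x y : C) :
    ‖f (star x * y)‖ ^ 2 ≤ (f (star x * x)).re * (f (star y * y)).re := by
  let _ := CStarAlgebra.spectralOrder C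
  have := CStarAlgebra.spectralOrderedRing C
  let F : C →ₚ[ℂ] ℂ := PositiveLinearMap.mk₀ f.toLinearMap fun x hx => hf.apply_nonneg hx
  have h := norm_inner_le_norm (𝕜 := ℂ) (F.toPreGNS x) (F.toPreGNS y)
  rw [PositiveLinearMap.preGNS_inner_def, PositiveLinearMap.preGNS_norm_def,
    PositiveLinearMap.preGNS_norm_def] at h
  have h2 := pow_le_pow_left₀ (norm_nonneg _) h 2
  rw [mul_pow, Real.sq_sqrt, Real.sq_sqrt] at h2
  · exact h2
  · exact (Complex.nonneg_iff.1 (hf y)).1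
  · exact (Complex.nonneg_iff.1 (hf x)).1

theorem IsPositive.re_apply_nonneg {f : C →L[ℂ] ℂ} (hf : IsPositive f) (x : C) :
    0 ≤ (f (star x * x)).re := (Complex.nonneg_iff.1 (hf x)).1

theorem re_apply_le {f : C →L[ℂ] ℂ} {x : C} {r : ℝ} (hx : ‖x‖ ≤ r) : (f x).re ≤ ‖f‖ * r :=
  (Complex.re_le_norm _).trans (f.le_opNorm_of_le hx)

theorem re_apply_star_mul_self_le (f : C →L[ℂ] ℂ) (x : C) :
    (f (star x * x)).re ≤ ‖f‖ * ‖x‖ ^ 2 :=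
  re_apply_le (by rw [CStarRing.norm_star_mul_self, sq])

/-- Cauchy–Schwarz for `e` and `x`, with `e` running through an approximate unit. A general bound
`M` is kept because `tendsto_approximateUnit` uses an `M` below `‖f‖`. -/
theorem norm_apply_sq_le_of_forall_le {f : C →L[ℂ] ℂ} (hf : IsPositive f) {M : ℝ} (x : C)
    (hM : ∀ e : C, ‖e‖ ≤ 1 → (f (star e * e)).re ≤ M) :
    ‖f x‖ ^ 2 ≤ M * (f (star x * x)).re := by
  let _ := CStarAlgebra.spectralOrder C
  have := CStarAlgebra.spectralOrderedRing C
  have hu := CStarAlgebra.increasingApproximateUnit C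
  have ht : Tendsto (fun e => ‖f (star e * x)‖ ^ 2) (CStarAlgebra.approximateUnit C)
      (𝓝 (‖f x‖ ^ 2)) := by
    refine ((f.continuous.tendsto _).comp ((hu.tendsto_mul_right x).congr' ?_)).norm.pow 2
    filter_upwards [hu.eventually_star_eq] with e he
    rw [he]
  have := hu.neBot
  refine le_of_tendsto ht ?_
  filter_upwards [hu.eventually_norm] with e he
  exact (hf.norm_apply_star_mul_sq_le e x).trans
    (mul_le_mul_of_nonneg_right (hM e he) (hf.re_apply_nonneg x))

theorem IsPositive.norm_apply_sq_le {f : C →L[ℂ] ℂ} (hf : IsPositive f) (x : C) :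
    ‖f x‖ ^ 2 ≤ ‖f‖ * (f (star x * x)).re :=
  norm_apply_sq_le_of_forall_le hf x fun e he => (re_apply_star_mul_self_le f e).trans
    (mul_le_of_le_one_right (norm_nonneg _) (pow_le_one₀ (norm_nonneg _) he))

theorem IsPositive.eq_zero_of_apply_star_mul_self {f : C →L[ℂ] ℂ} (hf : IsPositive f) {x : C}
    (h : f (star x * x) = 0) : f x = 0 := by
  have := hf.norm_apply_sq_le x
  rw [h, Complex.zero_re, mul_zero] at this
  exact norm_eq_zero.1 (pow_eq_zero_iff two_ne_zero |>.1 (le_antisymm this (sq_nonneg _)))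

/-- If `f ≤ M` on positive elements of norm below 1, two uses of the bound by `M` give `‖f x‖² ≤ M
f(x⋆x) ≤ M²‖x‖²`, so `‖f‖ ≤ M`. Additivity of the norm on positive functionals follows. -/
theorem IsPositive.tendsto_approximateUnit [PartialOrder C] [StarOrderedRing C] {f : C →L[ℂ] ℂ}
    (hf : IsPositive f) :
    Tendsto (fun e => (f e).re) (CStarAlgebra.approximateUnit C) (𝓝 ‖f‖) := by
  have hre : ∀ x : C, 0 ≤ x → 0 ≤ (f x).re := fun x hx =>
    (Complex.nonneg_iff.1 (hf.apply_nonneg hx)).1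
  have key : ∀ ε > 0, ∃ a : C, 0 ≤ a ∧ ‖a‖ < 1 ∧ ‖f‖ - ε < (f a).re := by
    intro ε hε
    by_contra! hcon
    set M := ‖f‖ - ε
    have hM0 : 0 ≤ M := by simpa using hcon 0 le_rfl (by simp)
    -- The assumption covers only norms strictly below 1, so `star e * e` is scaled by `r < 1` and
    -- `r → 1`.
    have hM : ∀ e : C, ‖e‖ ≤ 1 → (f (star e * e)).re ≤ M := by
      intro e he
      have ht : Tendsto (fun r : ℝ => r * (f (star e * e)).re) (𝓝[<] 1)
          (𝓝 (1 * (f (star e * e)).re)) :=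
        (tendsto_id.mono_left nhdsWithin_le_nhds).mul_const _
      rw [one_mul] at ht
      refine le_of_tendsto ht ?_
      filter_upwards [Ioo_mem_nhdsLT (zero_lt_one (α := ℝ))] with r hr
      have := hcon (r • (star e * e)) (smul_nonneg hr.1.le (star_mul_self_nonneg e)) (by
        rw [norm_smul, CStarRing.norm_star_mul_self, Real.norm_of_nonneg hr.1.le]
        nlinarith [norm_nonneg e, hr.1, hr.2, mul_le_one₀ he (norm_nonneg e) he])
      rw [← Complex.coe_smul, map_smul] at this
      simpa using this
    have : ‖f‖ ≤ M := by
      refine f.opNorm_le_bound hM0 fun x => ?_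
      refine le_of_sq_le_sq ?_ (by positivity)
      rcases eq_or_ne x 0 with rfl | hx
      · simp
      have hx0 : 0 < ‖x‖ := norm_pos_iff.2 hx
      refine (norm_apply_sq_le_of_forall_le hf x hM).trans ?_
      have h1 := hM (((‖x‖⁻¹ : ℝ) : ℂ) • x) (by
        rw [norm_smul]; simp [hx0.ne'])
      rw [star_smul, smul_mul_smul_comm, map_smul] at h1
      simp only [RCLike.star_def, Complex.conj_ofReal, ← Complex.ofReal_mul, smul_eq_mul,
        Complex.re_ofReal_mul] at h1
      have h2 : (f (star x * x)).re ≤ M * ‖x‖ ^ 2 := by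
        field_simp at h1
        linarith
      calc M * (f (star x * x)).re ≤ M * (M * ‖x‖ ^ 2) := mul_le_mul_of_nonneg_left h2 hM0
        _ = (M * ‖x‖) ^ 2 := by ring
    linarith
  have hu := CStarAlgebra.increasingApproximateUnit C
  refine tendsto_order.2 ⟨fun r hr => ?_, fun r hr => ?_⟩
  · obtain ⟨a, ha, ha1, hfa⟩ := key (‖f‖ - r) (sub_pos.2 hr)
    filter_upwards [(CStarAlgebra.hasBasis_approximateUnit C).mem_of_mem ⟨ha, ha1⟩] with e he
    have h1 := hre (e - a) (sub_nonneg.2 he.1)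
    rw [map_sub, Complex.sub_re] at h1
    linarith
  · filter_upwards [hu.eventually_norm] with e he
    have := re_apply_le (f := f) he
    linarith

theorem IsPositive.norm_add {f g : C →L[ℂ] ℂ} (hf : IsPositive f) (hg : IsPositive g) :
    ‖f + g‖ = ‖f‖ + ‖g‖ := by
  let _ := CStarAlgebra.spectralOrder C
  have := CStarAlgebra.spectralOrderedRing C
  refine tendsto_nhds_unique (hf.add hg).tendsto_approximateUnit ?_
  simpa using! hf.tendsto_approximateUnit.add hg.tendsto_approximateUnit

theorem IsPositive.norm_sum {ι : Type*} {F : ι → C →L[ℂ] ℂ} (hF : ∀ i, IsPositive (F i))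
    (s : Finset ι) : ‖∑ i ∈ s, F i‖ = ∑ i ∈ s, ‖F i‖ := by
  classical
  induction s using Finset.induction_on with
  | empty => simp
  | insert i s hi ih =>
    rw [Finset.sum_insert hi, Finset.sum_insert hi,
      (hF i).norm_add (IsPositive.sum s fun j _ => hF j), ih]

/-- A positive functional dominating another one of the same norm agrees with it. -/
theorem IsPositive.eq_of_norm_eq {f g : C →L[ℂ] ℂ} (hf : IsPositive f)
    (hfg : IsPositive (g - f)) (h : ‖g‖ = ‖f‖) : g = f := by
  have h1 := hf.norm_add hfg
  rw [add_sub_cancel, h] at h1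
  exact sub_eq_zero.1 (norm_eq_zero.1 (by linarith))

/-- Cauchy–Schwarz with `1 - e`, where the missing unit is replaced by an approximate unit `d`. The
bound is explicit in `x` because it is later applied to an `x` that varies with `e`. -/
theorem IsPositive.norm_apply_sub_mul_sq_le {g : C →L[ℂ] ℂ} (hg : IsPositive g) {e : C}
    (he : star e = e) (he1 : ‖e‖ ≤ 1) (x : C) :
    ‖g (x - e * x)‖ ^ 2 ≤ 2 * (‖g‖ - (g e).re) * (g (star x * x)).re := by
  let _ := CStarAlgebra.spectralOrder C
  have := CStarAlgebra.spectralOrderedRing C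
  have hu := CStarAlgebra.increasingApproximateUnit C
  have := hu.neBot
  have hl : Tendsto (fun d => ‖g (d * x - e * x)‖ ^ 2) (CStarAlgebra.approximateUnit C)
      (𝓝 (‖g (x - e * x)‖ ^ 2)) :=
    ((g.continuous.tendsto _).comp ((hu.tendsto_mul_right x).sub_const _)).norm.pow 2
  have hr : Tendsto (fun d => (‖g‖ - (g (d * e)).re - (g (e * d)).re + ‖g‖) *
      (g (star x * x)).re) (CStarAlgebra.approximateUnit C)
      (𝓝 ((‖g‖ - (g e).re - (g e).re + ‖g‖) * (g (star x * x)).re)) := by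
    have h1 := (Complex.continuous_re.tendsto _).comp
      ((g.continuous.tendsto _).comp (hu.tendsto_mul_right e))
    have h2 := (Complex.continuous_re.tendsto _).comp
      ((g.continuous.tendsto _).comp (hu.tendsto_mul_left e))
    exact (((tendsto_const_nhds.sub h1).sub h2).add_const _).mul_const _
  refine (le_of_tendsto_of_tendsto hl hr ?_).trans_eq (by ring)
  filter_upwards [hu.eventually_norm, hu.eventually_star_eq] with d hd hds
  have h1 := hg.norm_apply_star_mul_sq_le (d - e) x
  rw [star_sub, hds, he, sub_mul] at h1
  refine h1.trans (mul_le_mul_of_nonneg_right ?_ (hg.re_apply_nonneg x))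
  rw [show (d - e) * (d - e) = d * d - d * e - e * d + e * e by noncomm_ring]
  simp only [map_sub, map_add, Complex.sub_re, Complex.add_re]
  have h2 : (g (d * d)).re ≤ ‖g‖ * 1 := re_apply_le ((norm_mul_le _ _).trans
    (mul_le_one₀ hd (norm_nonneg _) hd))
  have h3 : (g (e * e)).re ≤ ‖g‖ * 1 := re_apply_le ((norm_mul_le _ _).trans
    (mul_le_one₀ he1 (norm_nonneg _) he1))
  linarith

end CStar

/-! ### Extending positive and pure functionals from a closed ideal. -/

section Ideal

variable {B : Type*} [NonUnitalCStarAlgebra B] {I : NonUnitalStarSubalgebra ℂ B}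

/-- The restriction of a functional to a `*`-subalgebra. -/
def restrict (I : NonUnitalStarSubalgebra ℂ B) (f : B →L[ℂ] ℂ) : I →L[ℂ] ℂ :=
  f.comp ⟨(NonUnitalStarSubalgebraClass.subtype I : I →ₗ[ℂ] B), continuous_subtype_val⟩

@[simp]
theorem restrict_apply (f : B →L[ℂ] ℂ) (x : I) : restrict I f x = f x := rfl

protected theorem IsPositive.restrict {f : B →L[ℂ] ℂ} (hf : IsPositive f) : IsPositive (restrict I f) :=
  fun x => hf x

theorem norm_restrict_le (f : B →L[ℂ] ℂ) : ‖restrict I f‖ ≤ ‖f‖ :=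
  ContinuousLinearMap.opNorm_le_bound _ (norm_nonneg _) fun x => f.le_opNorm x

variable [hI : IsClosed (I : Set B)]
  (hr : ∀ (x : I) (b : B), (x : B) * b ∈ I)

include hr in
/-- A positive functional on a closed ideal extends to a positive functional of the same norm,
which is the least among all positive extensions. -/
theorem IsPositive.exists_extension {g : I →L[ℂ] ℂ} (hg : IsPositive g) :
    ∃ G : B →L[ℂ] ℂ, IsPositive G ∧ restrict I G = g ∧ ‖G‖ = ‖g‖ ∧
      ∀ h : B →L[ℂ] ℂ, IsPositive h → restrict I h = g → IsPositive (h - G) := by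
  let _ := CStarAlgebra.spectralOrder I
  have := CStarAlgebra.spectralOrderedRing I
  have hu := CStarAlgebra.increasingApproximateUnit I
  have := hu.neBot
  -- The extension is `b ↦ lim g(e b e)`. Along an ultrafilter the limit of these bounded values
  -- exists by compactness.
  let U : Ultrafilter I := Ultrafilter.of (CStarAlgebra.approximateUnit I)
  have hU : (U : Filter I) ≤ CStarAlgebra.approximateUnit I := Ultrafilter.of_le _
  let c (b : B) (e : I) : I := ⟨e * b, hr e b⟩ * e
  have hnorm : ∀ b : B, ∀ e : I, ‖e‖ ≤ 1 → ‖g (c b e)‖ ≤ ‖g‖ * ‖b‖ := by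
    intro b e he
    refine g.le_opNorm_of_le ?_
    have he' : ‖(e : B)‖ ≤ 1 := he
    calc ‖(e : B) * b * e‖ ≤ ‖(e : B) * b‖ * ‖(e : B)‖ := norm_mul_le _ _
      _ ≤ ‖(e : B)‖ * ‖b‖ * ‖(e : B)‖ := by gcongr; exact norm_mul_le _ _
      _ ≤ 1 * ‖b‖ * 1 := by gcongr
      _ = ‖b‖ := by ring
  have hlim : ∀ b : B, ∃ z : ℂ, Tendsto (fun e => g (c b e)) U (𝓝 z) := by
    intro b
    obtain ⟨z, -, hz⟩ := (isCompact_closedBall (0 : ℂ) (‖g‖ * ‖b‖)).ultrafilter_le_nhds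
      (U.map fun e => g (c b e)) (by
        rw [Ultrafilter.coe_map, le_principal_iff, mem_map]
        filter_upwards [hU hu.eventually_norm] with e he
        simpa using hnorm b e he)
    exact ⟨z, hz⟩
  choose φ hφ using hlim
  have hc : ∀ (b : B) (e : I), (c b e : B) = e * b * e := fun _ _ => rfl
  let G : B →L[ℂ] ℂ := LinearMap.mkContinuous
    { toFun := φ
      map_add' := fun a b => tendsto_nhds_unique (hφ _) (((hφ a).add (hφ b)).congr fun e => by
        rw [← map_add]
        exact congrArg g (Subtype.ext (by
          simp only [NonUnitalStarSubalgebra.coe_add, hc]; noncomm_ring)))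
      map_smul' := fun r b => tendsto_nhds_unique (hφ _) (((hφ b).const_mul r).congr fun e => by
        rw [← smul_eq_mul, ← map_smul]
        exact congrArg g (Subtype.ext (by
          simp only [NonUnitalStarSubalgebra.coe_smul, hc, mul_smul_comm, smul_mul_assoc]))) }
    ‖g‖ fun b => le_of_tendsto (hφ b).norm (by
      filter_upwards [hU hu.eventually_norm] with e he using hnorm b e he)
  have hG : ∀ b, Tendsto (fun e => g (c b e)) U (𝓝 (G b)) := hφ
  have hGpos : IsPositive G := fun b => by
    refine ge_of_tendsto (hG _) ?_
    filter_upwards [hU hu.eventually_star_eq] with e he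
    have he' : star (e : B) = e := congrArg Subtype.val he
    have hx : b * e ∈ I := by
      simpa [he'] using star_mem (hr e (star b))
    convert hg ⟨b * e, hx⟩ using 2
    refine Subtype.ext ?_
    change (e : B) * (star b * b) * e = star (b * e) * (b * e)
    rw [star_mul, he']
    noncomm_ring
  have hGres : restrict I G = g := by
    ext x
    refine tendsto_nhds_unique (hG x) ?_
    have h1 : Tendsto (fun e : I => e * x * e) (CStarAlgebra.approximateUnit I) (𝓝 x) := by
      have h2 : Tendsto (fun e : I => (e * x - x) * e + x * e)
          (CStarAlgebra.approximateUnit I) (𝓝 (0 + x)) := by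
        refine Tendsto.add ?_ (hu.tendsto_mul_left x)
        refine squeeze_zero_norm' (a := fun e => ‖e * x - x‖) ?_ ?_
        · filter_upwards [hu.eventually_norm] with e he
          exact (norm_mul_le _ _).trans (mul_le_of_le_one_right (norm_nonneg _) he)
        · simpa using ((hu.tendsto_mul_right x).sub_const x).norm
      rw [zero_add] at h2
      refine h2.congr fun e => by noncomm_ring
    exact ((g.continuous.tendsto _).comp (h1.mono_left hU))
  refine ⟨G, hGpos, hGres, le_antisymm (LinearMap.mkContinuous_norm_le _ (norm_nonneg _) _)
    (by rw [← hGres]; exact norm_restrict_le G), fun h hh hres b => ?_⟩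
  have hhI : ∀ x : I, h x = g x := fun x => by rw [← hres]; rfl
  set d := star b * b with hd
  have hd_star : star d = d := by simp [hd]
  have hdI : ∀ e : I, star e = e → d * e ∈ I := fun e he => by
    have he' : star (e : B) = e := congrArg Subtype.val he
    simpa [he', hd_star] using star_mem (hr e d)
  -- On `I` the functional `h` is `g`, and `g e → ‖g‖` makes the Cauchy–Schwarz error vanish.
  have hclose : Tendsto (fun e : I => h (d * e - e * d * e)) U (𝓝 0) := by
    have hbd : Tendsto (fun e : I => √(2 * (‖g‖ - (g e).re) * (‖g‖ * ‖d‖ ^ 2))) U (𝓝 0) := by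
      have := ((((tendsto_const_nhds (x := ‖g‖)).sub
        (hg.tendsto_approximateUnit.mono_left hU)).const_mul 2).mul_const (‖g‖ * ‖d‖ ^ 2)).sqrt
      simpa using this
    refine squeeze_zero_norm' ?_ hbd
    filter_upwards [hU hu.eventually_star_eq, hU hu.eventually_norm] with e he he1
    refine Real.le_sqrt_of_sq_le ?_
    have h1 := hg.norm_apply_sub_mul_sq_le he he1 ⟨d * e, hdI e he⟩
    rw [← hhI] at h1
    have hnn : 0 ≤ ‖g‖ - (g e).re := by
      have := re_apply_le (f := g) he1
      linarith
    have heq : h (d * e - e * d * e) =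
        h ((⟨d * e, hdI e he⟩ - e * ⟨d * e, hdI e he⟩ : I) : B) := by
      simp [mul_assoc]
    rw [heq]
    refine h1.trans (mul_le_mul_of_nonneg_left ?_ (by linarith))
    refine (re_apply_star_mul_self_le g _).trans (mul_le_mul_of_nonneg_left ?_ (norm_nonneg _))
    refine pow_le_pow_left₀ (norm_nonneg _) ?_ 2
    exact (norm_mul_le d (e : B)).trans (mul_le_of_le_one_right (norm_nonneg _) he1)
  have h1 : Tendsto (fun e : I => h (e * d * e)) U (𝓝 (G d)) :=
    (hG d).congr fun e => (hhI _).symm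
  have h2 : Tendsto (fun e : I => h (d * e)) U (𝓝 (G d)) := by
    have := hclose.add h1
    rw [zero_add] at this
    exact this.congr fun e => by simp
  -- Limit of Cauchy–Schwarz for `h` at `b` and `b e`: `‖h(d e)‖² ≤ h(d) h(e d e)`. It forces `G d ≤
  -- h d`.
  have hsq : ‖G d‖ ^ 2 ≤ (h d).re * (G d).re := by
    refine le_of_tendsto_of_tendsto (h2.norm.pow 2)
      (((Complex.continuous_re.tendsto _).comp h1).const_mul (h d).re) ?_
    filter_upwards [hU hu.eventually_star_eq] with e he
    have he' : star (e : B) = e := congrArg Subtype.val he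
    have := hh.norm_apply_star_mul_sq_le b (b * e)
    rw [star_mul, he', ← mul_assoc, mul_assoc (e : B), ← mul_assoc (star b), ← hd] at this
    simpa [mul_assoc] using this
  have hGd := Complex.nonneg_iff.1 (hGpos b)
  have hhd := Complex.nonneg_iff.1 (hh b)
  rw [← hd] at hGd hhd
  rw [sub_apply, Complex.nonneg_iff]
  refine ⟨?_, by simp [← hGd.2, ← hhd.2]⟩
  rw [Complex.sub_re]
  have h3 : (G d).re ≤ ‖G d‖ := Complex.re_le_norm _
  by_contra! hcon
  nlinarith [hGd.1, hhd.1]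

include hr in
-- Both functionals dominate the least extension and have its norm, so both equal it.
theorem eq_of_restrict_eq {f h : B →L[ℂ] ℂ} (hf : IsPositive f) (hh : IsPositive h)
    (heq : restrict I f = restrict I h) (hfn : ‖f‖ ≤ ‖restrict I f‖)
    (hhn : ‖h‖ ≤ ‖restrict I h‖) : f = h := by
  obtain ⟨G, hG, -, hGn, hGmin⟩ := (hf.restrict (I := I)).exists_extension hr
  rw [hG.eq_of_norm_eq (hGmin f hf rfl)
      (le_antisymm (hfn.trans hGn.ge) (hGn.trans_le (norm_restrict_le f))),
    hG.eq_of_norm_eq (hGmin h hh heq.symm)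
      (le_antisymm (hhn.trans (by rw [← heq, hGn])) (hGn.trans_le (heq ▸ norm_restrict_le h)))]

include hr in
/-- The norm preserving positive extension of a pure functional on a closed ideal is pure. -/
theorem IsPure.of_restrict {f : B →L[ℂ] ℂ} (hf : IsPositive f) (hn : ‖f‖ ≤ ‖restrict I f‖)
    (hpure : IsPure (restrict I f)) : IsPure f := by
  refine ⟨hf, ?_, fun g hg hfg => ?_⟩
  · rintro rfl
    exact hpure.2.1 rfl
  obtain ⟨α, hα, hgα⟩ := hpure.2.2 (restrict I g) hg.restrict hfg.restrict
  refine ⟨α, hα, ?_⟩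
  -- Norms add both on `B` and on `I`, so norm preservation for `f` passes to its summand `g`; norm
  -- preserving extensions are unique.
  have h1 := hg.norm_add hfg
  have h2 := (hg.restrict (I := I)).norm_add (hfg.restrict (I := I))
  have h3 : restrict I g + restrict I (f - g) = restrict I f := by ext; simp
  rw [add_sub_cancel] at h1
  rw [h3] at h2
  have h4 := norm_restrict_le (I := I) (f - g)
  refine eq_of_restrict_eq (I := I) hr hg (hf.smul hα.1) (hgα.trans rfl) (by linarith) ?_
  change _ ≤ ‖(α : ℂ) • restrict I f‖
  rw [norm_smul, norm_smul]
  exact mul_le_mul_of_nonneg_left hn (norm_nonneg _)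

include hr in
/-- If a closed ideal is scattered, then every positive functional is a countable sum of pure
functionals and a positive functional vanishing on the ideal. -/
theorem IsScattered.exists_decomposition (hsc : IsScattered I) {f : B →L[ℂ] ℂ}
    (hf : IsPositive f) :
    ∃ (ι : Type) (_ : Countable ι) (F : ι → B →L[ℂ] ℂ) (f₀ : B →L[ℂ] ℂ),
      (∀ i, IsPure (F i)) ∧ IsPositive f₀ ∧ restrict I f₀ = 0 ∧
      ∀ b, HasSum (fun i => F i b) (f b - f₀ b) := by
  obtain ⟨ι, hι, g, hg, hsum⟩ := hsc (restrict I f) hf.restrict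
  choose G hG hGres hGn hGmin using fun i => (hg i).1.exists_extension hr
  have hrem : ∀ s : Finset ι, IsPositive (restrict I f - ∑ i ∈ s, g i) := by
    intro s x
    rw [sub_apply, sum_apply, sub_nonneg]
    exact sum_le_hasSum s (fun i _ => (hg i).1 x) (hsum _)
  have hsumpos : ∀ s : Finset ι, IsPositive (∑ i ∈ s, g i) := fun s =>
    IsPositive.sum s fun i _ => (hg i).1
  have hnorm : ∀ s : Finset ι, ‖restrict I f - ∑ i ∈ s, g i‖ + ∑ i ∈ s, ‖g i‖ = ‖restrict I f‖ := by
    intro s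
    rw [← IsPositive.norm_sum (fun i => (hg i).1), ← (hrem s).norm_add (hsumpos s),
      sub_add_cancel]
  -- Additivity bounds the partial sums of `‖G i‖ = ‖g i‖` by `‖restrict I f‖`, so the series
  -- converges in norm.
  have hsummable : Summable G := by
    refine Summable.of_norm (summable_of_sum_le (c := ‖restrict I f‖)
      (fun _ => norm_nonneg _) fun s => ?_)
    simp_rw [hGn]
    linarith [hnorm s, norm_nonneg (restrict I f - ∑ i ∈ s, g i)]
  have hSapply : ∀ b, HasSum (fun i => G i b) ((∑' i, G i) b) := fun b =>
    hsummable.hasSum.mapL (ContinuousLinearMap.apply ℂ ℂ b)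
  -- With `R` extending the tail, `R + ∑ G i` is a norm preserving extension of `restrict I f`,
  -- hence the least one `E`. Thus `f - ∑ G i = (f - E) + R`.
  have hpart : ∀ s : Finset ι, IsPositive (f - ∑ i ∈ s, G i) := by
    intro s
    obtain ⟨R, hR, hRres, hRn, -⟩ := (hrem s).exists_extension hr
    obtain ⟨E, hE, hEres, hEn, hEmin⟩ := (hf.restrict (I := I)).exists_extension hr
    have hGs : IsPositive (∑ i ∈ s, G i) := IsPositive.sum s fun i _ => hG i
    have hres : restrict I (R + ∑ i ∈ s, G i) = restrict I f := by
      ext x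
      have h1 : R x = f x - ∑ i ∈ s, g i x := by
        simpa [sum_apply] using DFunLike.congr_fun hRres x
      have h2 : ∀ i, G i x = g i x := fun i => DFunLike.congr_fun (hGres i) x
      simp [sum_apply, h1, h2]
    have hEeq : R + ∑ i ∈ s, G i = E := by
      refine eq_of_restrict_eq (I := I) hr (hR.add hGs) hE (hres.trans hEres.symm) ?_ ?_
      · rw [hres, hR.norm_add hGs, IsPositive.norm_sum hG, ← hnorm s, hRn]
        simp [hGn]
      · rw [hEres, hEn]
    have := (hEmin f hf rfl).add hR
    rwa [← hEeq, show f - (R + ∑ i ∈ s, G i) + R = f - ∑ i ∈ s, G i by abel] at this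
  refine ⟨ι, hι, G, f - ∑' i, G i, fun i => ?_, fun b => ?_, ?_, fun b => ?_⟩
  · exact IsPure.of_restrict (I := I) hr (hG i) (by rw [hGres, hGn]) (by rw [hGres]; exact hg i)
  · rw [sub_apply, sub_nonneg]
    refine hasSum_le_of_sum_le (hSapply _) fun s => ?_
    have := hpart s b
    rwa [sub_apply, sum_apply, sub_nonneg] at this
  · ext x
    rw [restrict_apply, sub_apply, zero_apply, sub_eq_zero]
    refine (hsum x).unique ?_
    convert hSapply x using 2 with i
    exact (DFunLike.congr_fun (hGres i) x).symm
  · simpa using hSapply b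

end Ideal

/-! ### The C⋆-completion of an algebra with a C⋆-seminorm. -/

section Completion

open UniformSpace UniformSpace.Completion Function

/-- The C⋆-identity for a submultiplicative seminorm. -/
class CStarSeminormed (X : Type*) [NonUnitalSeminormedRing X] [StarRing X] : Prop where
  norm_star_mul_self : ∀ x : X, ‖star x * x‖ = ‖x‖ ^ 2

variable {X : Type*} [NonUnitalSeminormedRing X] [StarRing X] [CStarSeminormed X]

theorem norm_star_eq (x : X) : ‖star x‖ = ‖x‖ := by
  have key : ∀ y : X, ‖y‖ ≤ ‖star y‖ := by
    intro y
    have h1 := CStarSeminormed.norm_star_mul_self y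
    have h2 := norm_mul_le (star y) y
    rcases (norm_nonneg y).eq_or_lt with h | h
    · rw [← h]; exact norm_nonneg _
    · nlinarith
  exact le_antisymm (by simpa using key (star x)) (key x)

instance completionMul : Mul (Completion X) :=
  ⟨curry <| (isDenseInducing_coe.prodMap isDenseInducing_coe).extend ((↑) ∘ uncurry (· * ·))⟩

theorem completion_coe_mul (a b : X) : ((a * b : X) : Completion X) = a * b :=
  ((isDenseInducing_coe.prodMap isDenseInducing_coe).extend_eq
      ((continuous_coe X).comp (@continuous_mul X _ _ _)) (a, b)).symm

/-- Multiplication is not uniformly continuous in general; joint continuity comes from extending a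
continuous biadditive map. -/
instance completionContinuousMul : ContinuousMul (Completion X) where
  continuous_mul := by
    let m := (AddMonoidHom.mul : X →+ X →+ X).compr₂ toCompl
    have : Continuous fun p : X × X => m p.1 p.2 := (continuous_coe X).comp continuous_mul
    have di : IsDenseInducing (toCompl : X → Completion X) := isDenseInducing_coe
    exact (di.extend_Z_bilin di this :)

instance completionNonUnitalRing : NonUnitalRing (Completion X) :=
  { (inferInstance : AddCommGroup (Completion X)), (inferInstance : Mul (Completion X)) with
    zero_mul := fun a => Completion.induction_on a
      (isClosed_eq (by fun_prop) continuous_const) fun a => by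
        rw [← coe_zero, ← completion_coe_mul, zero_mul]
    mul_zero := fun a => Completion.induction_on a
      (isClosed_eq (by fun_prop) continuous_const) fun a => by
        rw [← coe_zero, ← completion_coe_mul, mul_zero]
    mul_assoc := fun a b c => Completion.induction_on₃ a b c
      (isClosed_eq (by fun_prop) (by fun_prop)) fun a b c => by
        simp only [← completion_coe_mul, mul_assoc]
    left_distrib := fun a b c => Completion.induction_on₃ a b c
      (isClosed_eq (by fun_prop) (by fun_prop)) fun a b c => by
        simp only [← completion_coe_mul, ← coe_add, mul_add]
    right_distrib := fun a b c => Completion.induction_on₃ a b c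
      (isClosed_eq (by fun_prop) (by fun_prop)) fun a b c => by
        simp only [← completion_coe_mul, ← coe_add, add_mul] }

instance completionNonUnitalNormedRing : NonUnitalNormedRing (Completion X) :=
  { (inferInstance : NormedAddCommGroup (Completion X)),
    (inferInstance : NonUnitalRing (Completion X)) with
    norm_mul_le := fun a b => Completion.induction_on₂ a b
      (isClosed_le (by fun_prop) (by fun_prop)) fun a b => by
        simp only [← completion_coe_mul, norm_coe, norm_mul_le] }

theorem isometry_star : Isometry (star : X → X) :=
  AddMonoidHomClass.isometry_of_norm (starAddEquiv : X ≃+ X) norm_star_eq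

instance completionStar : Star (Completion X) := ⟨Completion.map star⟩

theorem completion_coe_star (a : X) : ((star a : X) : Completion X) = star (a : Completion X) :=
  (Completion.map_coe isometry_star.uniformContinuous a).symm

instance completionContinuousStar : ContinuousStar (Completion X) where
  continuous_star := Completion.continuous_map

instance completionStarRing : StarRing (Completion X) where
  star_involutive := fun a => Completion.induction_on a
    (isClosed_eq (by fun_prop) (by fun_prop)) fun a => by
      simp only [← completion_coe_star, star_star]
  star_mul := fun a b => Completion.induction_on₂ a b
    (isClosed_eq (by fun_prop) (by fun_prop)) fun a b => by
      simp only [← completion_coe_star, ← completion_coe_mul, star_mul]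
  star_add := fun a b => Completion.induction_on₂ a b
    (isClosed_eq (by fun_prop) (by fun_prop)) fun a b => by
      simp only [← completion_coe_star, ← coe_add, star_add]

instance completionCStarRing : CStarRing (Completion X) where
  norm_mul_self_le := fun a => Completion.induction_on a
    (isClosed_le (by fun_prop) (by fun_prop)) fun a => by
      rw [← completion_coe_star, ← completion_coe_mul, norm_coe, norm_coe,
        CStarSeminormed.norm_star_mul_self, sq]

variable [NormedSpace ℂ X] [IsScalarTower ℂ X X] [SMulCommClass ℂ X X] [StarModule ℂ X]

instance completionIsScalarTower : IsScalarTower ℂ (Completion X) (Completion X) :=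
  ⟨fun r a b => Completion.induction_on₂ a b
    (isClosed_eq ((continuous_fst.const_smul r).mul continuous_snd)
      ((continuous_fst.mul continuous_snd).const_smul r)) fun a b => by
      simp only [smul_eq_mul, ← completion_coe_mul, ← coe_smul, smul_mul_assoc]⟩

instance completionSMulCommClass : SMulCommClass ℂ (Completion X) (Completion X) :=
  ⟨fun r a b => Completion.induction_on₂ a b
    (isClosed_eq ((continuous_fst.mul continuous_snd).const_smul r)
      (continuous_fst.mul (continuous_snd.const_smul r))) fun a b => by
      simp only [smul_eq_mul, ← completion_coe_mul, ← coe_smul, mul_smul_comm]⟩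

instance completionStarModule : StarModule ℂ (Completion X) :=
  ⟨fun r a => Completion.induction_on a
    (isClosed_eq (continuous_id.const_smul r).star (continuous_star.const_smul (star r)))
    fun a => by simp only [← completion_coe_star, ← coe_smul, star_smul]⟩

/-- The completion is Hausdorff, so the kernel of the seminorm is divided out at the same time. -/
instance completionNonUnitalCStarAlgebra : NonUnitalCStarAlgebra (Completion X) where

variable (X) in
/-- The canonical map into the completion. -/
def toCompletion : X →⋆ₙₐ[ℂ] Completion X where
  toFun := (↑)
  map_smul' := fun r a => coe_smul r a
  map_zero' := coe_zero
  map_add' := coe_add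
  map_mul' := completion_coe_mul
  map_star' := completion_coe_star

theorem norm_toCompletion (a : X) : ‖toCompletion X a‖ = ‖a‖ := norm_coe a

end Completion

/-! ### Polynomials in a self-adjoint element. -/

section PolynomialCalculus

open Polynomial

/-- The value of a polynomial (without its constant term) at an element of a not necessarily
unital algebra. -/
def nonUnitalEval {A : Type*} [NonUnitalRing A] [Module ℂ A] [IsScalarTower ℂ A A]
    [SMulCommClass ℂ A A] (a : A) : ℂ[X] →ₗ[ℂ] A :=
  (Unitization.sndHom ℂ ℂ A).comp (aeval (a : Unitization ℂ A)).toLinearMap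

/-- The scalar component of `q(a)` in the unitization is `q(0)`. -/
theorem inr_nonUnitalEval {A : Type*} [NonUnitalRing A] [Module ℂ A] [IsScalarTower ℂ A A]
    [SMulCommClass ℂ A A] (a : A) {q : ℂ[X]} (hq : q.eval 0 = 0) :
    (nonUnitalEval a q : Unitization ℂ A) = aeval (a : Unitization ℂ A) q := by
  refine Unitization.ext ?_ rfl
  have := aeval_algHom_apply (Unitization.fstHom ℂ A) (a : Unitization ℂ A) q
  simp only [Unitization.fstHom_apply, Unitization.fst_inr] at this ⊢
  rw [← this, coe_aeval_eq_eval, hq]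

/-- In the unitization `q(a)` is given by the continuous functional calculus, and the spectrum of
`a` is real and bounded by `‖a‖`. -/
theorem norm_nonUnitalEval_le {C : Type*} [NonUnitalCStarAlgebra C] {a : C}
    (ha : IsSelfAdjoint a) {q : ℂ[X]} (hq : q.eval 0 = 0) {M : ℝ}
    (hM : ∀ t : ℝ, |t| ≤ ‖a‖ → ‖q.eval (t : ℂ)‖ ≤ M) : ‖nonUnitalEval a q‖ ≤ M := by
  have ha' : IsSelfAdjoint (a : Unitization ℂ C) := ha.inr ℂ
  have hM0 : 0 ≤ M := (norm_nonneg _).trans (hM 0 (by simp))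
  rw [← Unitization.norm_inr (𝕜 := ℂ), inr_nonUnitalEval a hq,
    ← cfc_polynomial q (a : Unitization ℂ C) ha'.isStarNormal]
  refine norm_cfc_le hM0 fun z hz => ?_
  have hzr := ha'.mem_spectrum_eq_re hz
  have h1 := spectrum.norm_le_norm_of_mem hz
  rw [Unitization.norm_inr] at h1
  rw [hzr]
  exact hM _ ((Complex.abs_re_le_norm z).trans h1)

theorem map_nonUnitalEval {A C : Type*} [NonUnitalRing A] [StarRing A] [Module ℂ A]
    [IsScalarTower ℂ A A] [SMulCommClass ℂ A A] [StarModule ℂ A] [NonUnitalCStarAlgebra C]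
    (φ : A →⋆ₙₐ[ℂ] C) (a : A) {q : ℂ[X]} (hq : q.eval 0 = 0) :
    φ (nonUnitalEval a q) = nonUnitalEval (φ a) q := by
  apply Unitization.inr_injective (R := ℂ)
  rw [inr_nonUnitalEval _ hq]
  have := aeval_algHom_apply (Unitization.starMap φ) (a : Unitization ℂ A) q
  rw [← inr_nonUnitalEval _ hq] at this
  simpa using this.symm

theorem norm_nonUnitalEval_le_of_seminormed {X : Type*} [NonUnitalSeminormedRing X] [StarRing X]
    [CStarSeminormed X] [NormedSpace ℂ X] [IsScalarTower ℂ X X] [SMulCommClass ℂ X X]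
    [StarModule ℂ X] {a : X} (ha : IsSelfAdjoint a) {q : ℂ[X]} (hq : q.eval 0 = 0) {M : ℝ}
    (hM : ∀ t : ℝ, |t| ≤ ‖a‖ → ‖q.eval (t : ℂ)‖ ≤ M) : ‖nonUnitalEval a q‖ ≤ M := by
  rw [← norm_toCompletion, map_nonUnitalEval _ _ hq]
  exact norm_nonUnitalEval_le (ha.map (toCompletion X)) hq (by rwa [norm_toCompletion])

variable {A : Type*} [NonUnitalRing A] [StarRing A] [Module ℂ A] [IsScalarTower ℂ A A]
  [SMulCommClass ℂ A A] [StarModule ℂ A]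

/-- A C⋆-seminorm of a polynomial in a self-adjoint element is bounded by the supremum of the
polynomial. -/
theorem seminorm_nonUnitalEval_le (p : Seminorm ℂ A) (hmul : ∀ a b, p (a * b) ≤ p a * p b)
    (hstar : ∀ a, p (star a * a) = p a ^ 2) {a : A} (ha : IsSelfAdjoint a) {q : ℂ[X]}
    (hq : q.eval 0 = 0) {M : ℝ} (hM : ∀ t : ℝ, |t| ≤ p a → ‖q.eval (t : ℂ)‖ ≤ M) :
    p (nonUnitalEval a q) ≤ M := by
  -- `A` is normed by `p` alone, so that its completion is a C⋆-algebra.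
  let _ : SeminormedAddCommGroup A := p.toAddGroupSeminorm.toSeminormedAddCommGroup
  let _ : NonUnitalSeminormedRing A :=
    { (inferInstance : SeminormedAddCommGroup A), (inferInstance : NonUnitalRing A) with
      norm_mul_le := hmul }
  let _ : NormedSpace ℂ A := { norm_smul_le := fun r a => (map_smul_eq_mul p r a).le }
  have : CStarSeminormed A := ⟨hstar⟩
  exact norm_nonUnitalEval_le_of_seminormed ha hq hM

end PolynomialCalculus

/-! ### Truncation to bounded elements. -/

section Truncation

open Polynomial

/-- The truncation `t ↦ max (-r) (min t r)` is a locally uniform limit of polynomials without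
constant term. -/
theorem exists_polynomial_near_clamp {r : ℝ} (hr : 0 ≤ r) (k : ℝ) {ε : ℝ} (hε : 0 < ε) :
    ∃ q : ℂ[X], q.eval 0 = 0 ∧
      ∀ t : ℝ, |t| ≤ k → ‖q.eval (t : ℂ) - ((max (-r) (min t r) : ℝ) : ℂ)‖ ≤ ε := by
  -- The interval contains 0 for every `k`. The truncation vanishes there, so removing the constant
  -- term costs only the other `ε / 2`.
  obtain ⟨q, hq⟩ := exists_polynomial_near_of_continuousOn (-|k|) |k|
    (fun t => max (-r) (min t r)) (by fun_prop) (ε / 2) (half_pos hε)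
  have h0 := hq 0 (by simp)
  rw [min_eq_left hr, max_eq_right (by linarith : -r ≤ 0), sub_zero] at h0
  refine ⟨(q - C (q.eval 0)).map (algebraMap ℝ ℂ), by
    simp [eval_map, coeff_zero_eq_eval_zero], fun t ht => ?_⟩
  have ht' := hq t (abs_le.1 (ht.trans (le_abs_self k)))
  have h1 : ((q - C (q.eval 0)).map (algebraMap ℝ ℂ)).eval (t : ℂ) =
      ((q.eval t - q.eval 0 : ℝ) : ℂ) := by
    rw [eval_map_algebraMap, ← Complex.coe_algebraMap, aeval_algebraMap_apply]
    simp
  rw [h1, ← Complex.ofReal_sub, Complex.norm_real, Real.norm_eq_abs]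
  rw [abs_le]
  rw [abs_lt] at h0 ht'
  constructor <;> linarith [h0.1, h0.2, ht'.1, ht'.2]

theorem cauchySeq_of_seminorms {A Λ : Type*} [AddCommGroup A] [Module ℂ A] [UniformSpace A]
    [IsUniformAddGroup A] {p : Λ → Seminorm ℂ A} (hp : WithSeminorms p) {u : ℕ → A}
    (h : ∀ l, ∀ ε > 0, ∃ N, ∀ m ≥ N, ∀ n ≥ N, p l (u m - u n) < ε) : CauchySeq u := by
  rw [cauchySeq_iff_tendsto, uniformity_eq_comap_nhds_zero, tendsto_comap_iff,
    hp.tendsto_nhds]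
  intro l ε hε
  obtain ⟨N, hN⟩ := h l ε hε
  filter_upwards [eventually_ge_atTop (N, N)] with mn hmn
  simpa using hN mn.2 hmn.2 mn.1 hmn.1

variable {A : Type*} [NonUnitalRing A] [StarRing A] [Module ℂ A] [IsScalarTower ℂ A A]
  [SMulCommClass ℂ A A] [StarModule ℂ A] [UniformSpace A] [IsUniformAddGroup A]
  {Λ : Type*} [Nonempty Λ] {p : Λ → Seminorm ℂ A}

/-- A self-adjoint element is bounded modulo the kernel of each seminorm. -/
theorem IsLocallyCStarAlgebra.exists_bounded_of_isSelfAdjoint (hp : IsLocallyCStarAlgebra p)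
    (l : Λ) {a : A} (ha : IsSelfAdjoint a) :
    ∃ b : A, (∀ m, p m b ≤ p l a) ∧ p l (a - b) = 0 := by
  set r := p l a
  have hr : 0 ≤ r := apply_nonneg _ _
  let φ : ℝ → ℝ := fun t => max (-r) (min t r)
  have hφ : ∀ t, ‖(φ t : ℂ)‖ ≤ r := fun t => by
    rw [Complex.norm_real, Real.norm_eq_abs, abs_le]
    exact ⟨le_max_left _ _, max_le (by linarith) (min_le_right _ _)⟩
  have hφid : ∀ t, |t| ≤ r → φ t = t := fun t ht => by
    have := abs_le.1 ht
    simp [φ, this.1, this.2]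
  -- `q k` is `1/(k+1)`-close to the truncation on `[-k, k]`, which contains `[-p m a, p m a]` once
  -- `k ≥ p m a`; one sequence thus serves all seminorms.
  choose q hq0 hq using fun k : ℕ => exists_polynomial_near_clamp hr k
    (Nat.one_div_pos_of_nat (α := ℝ) (n := k))
  let u : ℕ → A := fun k => nonUnitalEval a (q k)
  have hsmall : ∀ (m : Λ) (t : ℝ) (k : ℕ), |t| ≤ p m a → p m a ≤ k →
      ‖(q k).eval (t : ℂ) - (φ t : ℂ)‖ ≤ 1 / ((k : ℝ) + 1) :=
    fun m t k ht hk => hq k t (ht.trans hk)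
  have hcauchy : CauchySeq u := by
    refine cauchySeq_of_seminorms hp.withSeminorms fun m ε hε => ?_
    obtain ⟨N₁, hN₁⟩ := exists_nat_ge (p m a)
    obtain ⟨N₂, hN₂⟩ := exists_nat_one_div_lt (half_pos hε)
    refine ⟨max N₁ N₂, fun i hi j hj => ?_⟩
    have hk : ∀ k ≥ max N₁ N₂, p m a ≤ k ∧ 1 / ((k : ℝ) + 1) ≤ 1 / ((N₂ : ℝ) + 1) := by
      intro k hk
      refine ⟨hN₁.trans (by exact_mod_cast (le_max_left _ _).trans hk), ?_⟩
      have : (N₂ : ℝ) ≤ k := by exact_mod_cast (le_max_right _ _).trans hk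
      gcongr
    rw [show u i - u j = nonUnitalEval a (q i - q j) from (map_sub _ _ _).symm]
    refine (seminorm_nonUnitalEval_le (p m) (hp.map_mul_le m) (hp.map_star_mul_self m) ha
      (by simp [hq0]) (M := 1 / ((N₂ : ℝ) + 1) + 1 / ((N₂ : ℝ) + 1)) fun t ht => ?_).trans_lt
      (by linarith)
    rw [eval_sub, ← sub_sub_sub_cancel_right _ _ (φ t : ℂ)]
    refine (norm_sub_le _ _).trans (add_le_add ?_ ?_)
    · exact (hsmall m t i ht (hk i hi).1).trans (hk i hi).2
    · exact (hsmall m t j ht (hk j hj).1).trans (hk j hj).2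
  have := hp.completeSpace
  obtain ⟨b, hb⟩ := cauchySeq_tendsto_of_complete hcauchy
  have hlim : Tendsto (fun k : ℕ => 1 / ((k : ℝ) + 1)) atTop (𝓝 0) :=
    tendsto_one_div_add_atTop_nhds_zero_nat
  refine ⟨b, fun m => ?_, le_antisymm ?_ (apply_nonneg _ _)⟩
  · have h1 : Tendsto (fun k => p m (u k)) atTop (𝓝 (p m b)) :=
      ((hp.withSeminorms.continuous_seminorm m).tendsto _).comp hb
    have h2 := hlim.add_const r
    rw [zero_add] at h2
    refine le_of_tendsto_of_tendsto h1 h2 ?_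
    filter_upwards [eventually_ge_atTop ⌈p m a⌉₊] with k hk
    refine seminorm_nonUnitalEval_le (p m) (hp.map_mul_le m) (hp.map_star_mul_self m) ha
      (hq0 k) fun t ht => ?_
    rw [← sub_add_cancel ((q k).eval (t : ℂ)) (φ t : ℂ)]
    exact (norm_add_le _ _).trans (add_le_add (hsmall m t k ht (Nat.ceil_le.1 hk)) (hφ t))
  -- The truncation is the identity on `[-r, r]` with `r = p l a`, so `X - q k` is small there.
  · have h1 : Tendsto (fun k => p l (a - u k)) atTop (𝓝 (p l (a - b))) :=
      ((hp.withSeminorms.continuous_seminorm l).tendsto _).comp (tendsto_const_nhds.sub hb)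
    refine le_of_tendsto_of_tendsto h1 hlim ?_
    filter_upwards [eventually_ge_atTop ⌈p l a⌉₊] with k hk
    have hX : nonUnitalEval a (X : ℂ[X]) = a := by simp [nonUnitalEval]
    rw [show a - u k = nonUnitalEval a (X - q k) by rw [map_sub, hX]]
    refine seminorm_nonUnitalEval_le (p l) (hp.map_mul_le l) (hp.map_star_mul_self l) ha
      (by simp [hq0]) fun t ht => ?_
    rw [eval_sub, eval_X, norm_sub_rev]
    have := hsmall l t k ht (Nat.ceil_le.1 hk)
    rwa [hφid t ht] at this

namespace BoundedElements

variable {hp : IsLocallyCStarAlgebra p}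

variable (hp) in
/-- The bounded elements surject onto the quotient by the kernel of each seminorm, with
control of the norm. -/
theorem exists_map_sub_incl_eq_zero (l : Λ) (a : A) :
    ∃ b : BoundedElements hp, p l (a - incl hp b) = 0 ∧ ‖b‖ ≤ 2 * p l a := by
  have hre : p l (realPart a : A) ≤ p l a := by
    rw [realPart_apply_coe, ← Complex.coe_smul, map_smul_eq_mul]
    have := map_add_le_add (p l) a (star a)
    rw [hp.map_star] at this
    norm_num
    linarith
  have him : p l (imaginaryPart a : A) ≤ p l a := by
    rw [imaginaryPart_apply_coe, map_smul_eq_mul, ← Complex.coe_smul, map_smul_eq_mul]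
    have := map_sub_le_add (p l) a (star a)
    rw [hp.map_star] at this
    norm_num
    linarith
  obtain ⟨x, hx, hx0⟩ := hp.exists_bounded_of_isSelfAdjoint l (realPart a).2
  obtain ⟨y, hy, hy0⟩ := hp.exists_bounded_of_isSelfAdjoint l (imaginaryPart a).2
  have hb : ∀ m, p m (x + Complex.I • y) ≤ 2 * p l a := fun m => by
    refine (map_add_le_add (p m) _ _).trans ?_
    rw [map_smul_eq_mul, Complex.norm_I, one_mul]
    linarith [hx m, hy m]
  refine ⟨⟨x + Complex.I • y, 2 * p l a, ?_⟩, ?_, norm_le hb⟩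
  · rintro _ ⟨m, rfl⟩
    exact hb m
  · change p l (a - (x + Complex.I • y)) = 0
    nth_rw 1 [← realPart_add_I_smul_imaginaryPart a]
    rw [add_sub_add_comm, ← smul_sub]
    refine le_antisymm ((map_add_le_add (p l) _ _).trans ?_) (apply_nonneg _ _)
    rw [map_smul_eq_mul, hx0, hy0, mul_zero, add_zero]

end BoundedElements

end Truncation

/-! ### Functionals on `A` and on `b(A)`; the two implications. -/

section Scattered

variable {A : Type*} [NonUnitalRing A] [StarRing A] [Module ℂ A] [IsScalarTower ℂ A A]
  [SMulCommClass ℂ A A] [StarModule ℂ A] [UniformSpace A] [IsUniformAddGroup A]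
  {Λ : Type*} [Nonempty Λ] {p : Λ → Seminorm ℂ A}

/-- Continuity bounds `f` by finitely many seminorms, and directedness by a single one. -/
theorem IsLocallyCStarAlgebra.exists_eq_zero (hp : IsLocallyCStarAlgebra p) (f : A →L[ℂ] ℂ) :
    ∃ l, ∀ a, p l a = 0 → f a = 0 := by
  obtain ⟨s, C, -, hC⟩ := Seminorm.bound_of_continuous hp.withSeminorms
    ((normSeminorm ℂ ℂ).comp f.toLinearMap) (continuous_norm.comp f.continuous)
  obtain ⟨l, hl⟩ := hp.directed.finset_le s
  refine ⟨l, fun a ha => ?_⟩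
  have h1 : s.sup p ≤ p l := Finset.sup_le hl
  have h2 : ‖f a‖ ≤ C * s.sup p a := hC a
  have h3 : s.sup p a = 0 := le_antisymm ((h1 a).trans ha.le) (apply_nonneg _ _)
  rw [h3, mul_zero] at h2
  exact norm_le_zero_iff.1 h2

namespace BoundedElements

variable {hp : IsLocallyCStarAlgebra p}

variable (hp) in
/-- The restriction of a continuous functional to the bounded elements. -/
def pullback (f : A →L[ℂ] ℂ) : BoundedElements hp →L[ℂ] ℂ :=
  f.comp ⟨(incl hp : BoundedElements hp →ₗ[ℂ] A), continuous_incl⟩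

@[simp]
theorem pullback_apply (f : A →L[ℂ] ℂ) (b : BoundedElements hp) :
    pullback hp f b = f (incl hp b) := rfl

theorem isPositive_pullback {f : A →L[ℂ] ℂ} (hf : IsPositive f) :
    IsPositive (pullback hp f) := fun b => by
  rw [pullback_apply, map_mul, map_star]
  exact hf _

theorem map_star_mul_self_eq_zero {l : Λ} {b : BoundedElements hp} (hb : p l (incl hp b) = 0) :
    p l (incl hp (star b * b)) = 0 := by
  rw [map_mul, map_star, hp.map_star_mul_self, hb, sq, mul_zero]

theorem map_star_mul_self_sub {l : Λ} {a : A} {b : BoundedElements hp}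
    (hab : p l (a - incl hp b) = 0) : p l (star a * a - incl hp (star b * b)) = 0 := by
  rw [map_mul, map_star, show star a * a - star (incl hp b) * incl hp b =
    star a * (a - incl hp b) + star (a - incl hp b) * incl hp b by rw [star_sub]; noncomm_ring]
  refine le_antisymm ((map_add_le_add (p l) _ _).trans ?_) (apply_nonneg _ _)
  refine (add_le_add (hp.map_mul_le l _ _) (hp.map_mul_le l _ _)).trans ?_
  rw [hp.map_star, hp.map_star, hab]
  simp

/-- A functional on the bounded elements which vanishes on the kernel of a seminorm descends to
a continuous functional on the whole algebra. -/
theorem exists_descent {l : Λ} (g : BoundedElements hp →L[ℂ] ℂ)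
    (hg : ∀ b, p l (incl hp b) = 0 → g b = 0) :
    ∃ G : A →L[ℂ] ℂ, pullback hp G = g ∧
      ∀ (a : A) (b : BoundedElements hp), p l (a - incl hp b) = 0 → G a = g b := by
  -- The descended functional is `g ∘ β`: independence of the lift gives linearity, and the bound on
  -- `‖β a‖` gives continuity.
  choose β hβ hβn using exists_map_sub_incl_eq_zero hp l
  have huniq : ∀ (a : A) (b : BoundedElements hp), p l (a - incl hp b) = 0 → g (β a) = g b := by
    intro a b hab
    rw [← sub_eq_zero, ← map_sub]
    refine hg _ (le_antisymm ?_ (apply_nonneg _ _))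
    rw [map_sub, ← sub_sub_sub_cancel_left _ _ a]
    exact (map_sub_le_add (p l) _ _).trans (by rw [hab, hβ, add_zero])
  let G₀ : A →ₗ[ℂ] ℂ :=
    { toFun := fun a => g (β a)
      map_add' := fun a b => by
        rw [huniq (a + b) (β a + β b), map_add]
        rw [map_add, add_sub_add_comm]
        exact le_antisymm ((map_add_le_add (p l) _ _).trans (by rw [hβ, hβ, add_zero]))
          (apply_nonneg _ _)
      map_smul' := fun r a => by
        rw [huniq (r • a) (r • β a), map_smul, RingHom.id_apply]
        rw [map_smul, ← smul_sub, map_smul_eq_mul, hβ, mul_zero] }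
  refine ⟨⟨G₀, ?_⟩, ContinuousLinearMap.ext fun b => huniq (incl hp b) b ?_, huniq⟩
  swap
  · rw [sub_self, map_zero]
  refine WithSeminorms.continuous_of_isBounded hp.withSeminorms (norm_withSeminorms ℂ ℂ) G₀ ?_
  refine fun _ => ⟨{l}, ‖g‖₊ * 2, fun a => ?_⟩
  rw [Finset.sup_singleton]
  change ‖g (β a)‖ ≤ ‖g‖ * 2 * p l a
  rw [mul_assoc]
  exact g.le_opNorm_of_le (hβn a)

/-- The difference kills some `ker p l`, modulo which every element is bounded. -/
theorem eq_of_pullback_eq {f g : A →L[ℂ] ℂ} (h : pullback hp f = pullback hp g) : f = g := by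
  obtain ⟨l, hl⟩ := hp.exists_eq_zero (f - g)
  ext a
  obtain ⟨b, hb, -⟩ := exists_map_sub_incl_eq_zero hp l a
  have h1 := hl _ hb
  have h2 : f (incl hp b) = g (incl hp b) := DFunLike.congr_fun h b
  rw [map_sub, sub_apply, sub_apply, h2, sub_self, sub_zero] at h1
  exact sub_eq_zero.1 h1

theorem isPositive_of_pullback {f : A →L[ℂ] ℂ} (hf : IsPositive (pullback hp f)) :
    IsPositive f := fun a => by
  obtain ⟨l, hl⟩ := hp.exists_eq_zero f
  obtain ⟨b, hb, -⟩ := exists_map_sub_incl_eq_zero hp l a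
  have h1 := hl _ (map_star_mul_self_sub hb)
  rw [map_sub, sub_eq_zero] at h1
  rw [h1]
  exact hf b

theorem isPositive_pullback_iff {f : A →L[ℂ] ℂ} :
    IsPositive (pullback hp f) ↔ IsPositive f :=
  ⟨isPositive_of_pullback, isPositive_pullback⟩

/-- A positive functional on the bounded elements which is dominated by a functional vanishing
on the kernel of a seminorm is the restriction of a functional on the whole algebra. -/
theorem exists_pullback_eq {l : Λ} {f g : BoundedElements hp →L[ℂ] ℂ}
    (hf : ∀ b, p l (incl hp b) = 0 → f b = 0) (hg : IsPositive g)
    (hgf : ∀ b, g (star b * b) ≤ f (star b * b)) :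
    ∃ G : A →L[ℂ] ℂ, pullback hp G = g := by
  obtain ⟨G, hG, -⟩ := exists_descent (l := l) g fun b hb =>
    hg.eq_zero_of_apply_star_mul_self (le_antisymm
      ((hgf b).trans_eq (hf _ (map_star_mul_self_eq_zero hb))) (hg b))
  exact ⟨G, hG⟩

/-- A functional is pure if and only if its restriction to the bounded elements is pure. -/
theorem isPure_pullback_iff {f : A →L[ℂ] ℂ} : IsPure (pullback hp f) ↔ IsPure f := by
  have h0 : pullback hp f = 0 ↔ f = 0 :=
    ⟨fun h => eq_of_pullback_eq (hp := hp) (h.trans rfl), fun h => by rw [h]; rfl⟩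
  unfold IsPure
  rw [isPositive_pullback_iff, Ne, h0]
  refine and_congr_right fun hf => and_congr_right fun _ => ⟨fun h g hg hfg => ?_,
    fun h g hg hfg => ?_⟩
  · obtain ⟨α, hα, hgα⟩ := h (pullback hp g) (isPositive_pullback hg) (isPositive_pullback hfg)
    exact ⟨α, hα, eq_of_pullback_eq (hgα.trans rfl)⟩
  -- Competitors of the restriction on `b(A)` are dominated by it, hence themselves come from `A`.
  · obtain ⟨l, hl⟩ := hp.exists_eq_zero f
    obtain ⟨G, rfl⟩ := exists_pullback_eq (l := l) (f := pullback hp f)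
      (fun b hb => hl _ hb) hg fun b => sub_nonneg.1 (hfg b)
    obtain ⟨α, hα, hgα⟩ := h G (isPositive_of_pullback hg) (isPositive_of_pullback (hp := hp) hfg)
    exact ⟨α, hα, by rw [hgα]; rfl⟩

theorem isScattered_of_boundedElements (h : IsScattered (BoundedElements hp)) :
    IsScattered A := by
  intro f hf
  obtain ⟨ι, hι, g, hg, hsum⟩ := h (pullback hp f) (isPositive_pullback hf)
  obtain ⟨l, hl⟩ := hp.exists_eq_zero f
  have hgI : ∀ i b, p l (incl hp b) = 0 → g i b = 0 := fun i b hb =>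
    (hg i).1.eq_zero_of_apply_star_mul_self (le_antisymm
      ((IsPositive.apply_le_of_hasSum (fun i => (hg i).1) hsum i b).trans_eq
        (hl _ (map_star_mul_self_eq_zero hb))) ((hg i).1 b))
  choose G hGg hG using fun i => exists_descent (g i) (hgI i)
  refine ⟨ι, hι, G, fun i => (isPure_pullback_iff (hp := hp)).1 (by rw [hGg]; exact hg i),
    fun a => ?_⟩
  -- All summands kill the same `ker p l`, so one bounded `b` replaces `a` throughout the series.
  obtain ⟨b, hb, -⟩ := exists_map_sub_incl_eq_zero hp l a
  have h1 := hl _ hb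
  rw [map_sub, sub_eq_zero] at h1
  rw [h1]
  have h2 := hsum b
  rw [pullback_apply] at h2
  simpa only [hG _ a b hb] using h2

theorem isClosed_kerIdeal (l : Λ) : IsClosed (kerIdeal hp l : Set (BoundedElements hp)) :=
  isClosed_eq ((hp.withSeminorms.continuous_seminorm l).comp continuous_incl) continuous_const

/-- The ideal accounts for one family of pure summands; the remainder kills the ideal and is
decomposed on `A`. -/
theorem isScattered_of_kerIdeal (h : IsScattered A) {l : Λ} (hl : IsScattered (kerIdeal hp l)) :
    IsScattered (BoundedElements hp) := by
  intro f hf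
  have hclosed := isClosed_kerIdeal (hp := hp) l
  have hideal : ∀ (x : kerIdeal hp l) (b : BoundedElements hp),
      (x : BoundedElements hp) * b ∈ kerIdeal hp l := fun x b => by
    refine le_antisymm ?_ (apply_nonneg _ _)
    rw [map_mul]
    refine (hp.map_mul_le l _ _).trans ?_
    rw [show p l (incl hp x) = 0 from x.2, zero_mul]
  obtain ⟨ι, hι, F, f₀, hF, hf₀, hres, hsum⟩ := hl.exists_decomposition hideal hf
  obtain ⟨G, rfl⟩ := exists_pullback_eq (l := l) (f := f₀)
    (fun b hb => DFunLike.congr_fun hres ⟨b, hb⟩) hf₀ fun b => le_rfl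
  obtain ⟨κ, hκ, H, hH, hHsum⟩ := h G (isPositive_of_pullback hf₀)
  refine ⟨ι ⊕ κ, inferInstance, Sum.elim F fun k => pullback hp (H k), ?_, fun b => ?_⟩
  · rintro (i | k)
    · exact hF i
    · exact isPure_pullback_iff.2 (hH k)
  · have := HasSum.sum (f := fun j => Sum.elim F (fun k => pullback hp (H k)) j b) (hsum b)
      (hHsum (incl hp b))
    simpa using this

end BoundedElements

end Scattered

end LocallyCStar

end

theorem mainTheorem12 {A : Type*} [NonUnitalRing A] [StarRing A] [Module ℂ A]
    [IsScalarTower ℂ A A] [SMulCommClass ℂ A A] [StarModule ℂ A]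
    [UniformSpace A] [IsUniformAddGroup A] {Λ : Type*} [Nonempty Λ]
    (p : Λ → Seminorm ℂ A) (hp : LocallyCStar.IsLocallyCStarAlgebra p) :
    (LocallyCStar.IsScattered (LocallyCStar.BoundedElements hp) → LocallyCStar.IsScattered A) ∧
    (LocallyCStar.IsScattered A →
      (∃ l : Λ, LocallyCStar.IsScattered (LocallyCStar.BoundedElements.kerIdeal hp l)) →
      LocallyCStar.IsScattered (LocallyCStar.BoundedElements hp)) := by
  exact ⟨LocallyCStar.BoundedElements.isScattered_of_boundedElements,
    fun h ⟨_, hl⟩ => LocallyCStar.BoundedElements.isScattered_of_kerIdeal h hl⟩
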